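/- Let $E$ be a Polish space, and let $\mathcal M_1$ be the set of all Borel probability measures on $E$, equipped with the weak topology $\mathcal O_{\rm w}$. Let $(\psi_k)_{k\in\mathbb N}$ be any sequence of gauge functions, i.e. of continuous functions $\psi_k:E\to[0,\infty)$. Let $\mathcal M_1^{(\psi_k)}$ be the set of all $\mu\in\mathcal M_1$ with $\int\psi_k\,d\mu<\infty$ for every $k\in\mathbb N$, let $\mathcal C_{\psi_k}$ be the space of all continuous functions $f:E\to\mathbb R$ with $\sup_{x\in E}|f(x)/(1+\psi_k(x))|<\infty$, and let the $(\psi_k)$-weak topology $\mathcal O_{(\psi_k)}$ be the coarsest topology on $\mathcal M_1^{(\psi_k)}$ for which all maps $\mu\mapsto\int f\,d\mu$, $f\in\mathcal C_{\psi_k}$, $k\in\mathbb N$, are continuous. A set $N\subseteq\mathcal M_1$ is called locally uniformly $(\psi_k)$-integrating if for every $\mu\in N$, $\varepsilon>0$ and $k\in\mathbb N$ there exist $a>0$ and a weakly open neighborhood $U$ of $\mu$ such that $\int\psi_k\mathbf 1_{\{\psi_k\ge a\}}\,d\nu\le\varepsilon$ for all $\nu\in N\cap U$. It is called uniformly $(\psi_k)$-integrating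 if for every $\varepsilon>0$ and $k\in\mathbb N$ there exists $a>0$ such that $\sup_{\mu\in N}\int\psi_k\mathbf 1_{\{\psi_k\ge a\}}\,d\mu\le\varepsilon$. A sequence in $\mathcal M_1$ is called uniformly $(\psi_k)$-integrating if the set of its members is. Let $M\subseteq\mathcal M_1^{(\psi_k)}$. Then the following conditions are equivalent: (a) $M$ is a w-set in $\mathcal M_1^{(\psi_k)}$, i.e. $\mathcal O_{(\psi_k)}\cap M=\mathcal O_{\rm w}\cap M$: the relative $(\psi_k)$-weak topology and the relative weak topology on $M$ coincide. (b) $M$ is locally uniformly $(\psi_k)$-integrating. (c) Every weakly compact subset of $M$ is uniformly $(\psi_k)$-integrating. (d) Every sequence in $M$ that converges weakly to an element of $M$ is uniformly $(\psi_k)$-integrating. (e) For every sequence $(\mu_n)_{n\ge1}$ in $M$ and every $\mu_0\in M$ such that $\mu_n\to\mu_0$ weakly, $\int\psi_k\,d\mu_n\to\int\psi_k\,d\mu_0$ for all $k\in\mathbb N$. -/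

import Mathlib

open MeasureTheory Filter Topology
open scoped NNReal ENNReal

noncomputable section

namespace PsiWeak

variable {E : Type*} [TopologicalSpace E] [MeasurableSpace E]

/-- The space `C_φ` of all continuous `f : E → ℝ` with `sup_x |f x / (1 + φ x)| < ∞`,
for a gauge function `φ`, i.e. a continuous function `φ : E → [0, ∞)`. -/
def growthSpace (φ : C(E, ℝ≥0)) : Set (E → ℝ) :=
  {f | Continuous f ∧ BddAbove (Set.range fun x => |f x / (1 + (φ x : ℝ))|)}

/-- The set of all probability measures `μ` on `E` with `∫ ψ_k dμ < ∞` for every `k`. -/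
def gaugeMeasures (ψ : ℕ → C(E, ℝ≥0)) : Set (ProbabilityMeasure E) :=
  {μ | ∀ k, (∫⁻ x, (ψ k x : ℝ≥0∞) ∂(μ : Measure E)) < ∞}

/-- The `(ψ_k)`-weak topology: the coarsest topology on `gaugeMeasures ψ` for which all maps
`μ ↦ ∫ f dμ`, `f ∈ C_{ψ_k}`, `k ∈ ℕ`, are continuous. It is not an instance: the instance on
this subtype is the relative weak topology. -/
@[reducible]
def gaugeWeakTopology (ψ : ℕ → C(E, ℝ≥0)) : TopologicalSpace (gaugeMeasures ψ) :=
  ⨅ (k : ℕ) (f ∈ growthSpace (ψ k)),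
    TopologicalSpace.induced
      (fun μ : gaugeMeasures ψ => ∫ x, f x ∂((μ : ProbabilityMeasure E) : Measure E))
      inferInstance

/-- `M` is a w-set: the relative `(ψ_k)`-weak topology and the relative weak topology on `M`
coincide. -/
def IsWSet [OpensMeasurableSpace E] (ψ : ℕ → C(E, ℝ≥0)) (M : Set (ProbabilityMeasure E))
    (hM : M ⊆ gaugeMeasures ψ) : Prop :=
  TopologicalSpace.induced (Set.inclusion hM) (gaugeWeakTopology ψ) =
    TopologicalSpace.induced (Subtype.val : M → ProbabilityMeasure E) inferInstance

/-- Locally uniformly `(ψ_k)`-integrating sets of probability measures. -/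
def LocallyUniformlyIntegrating [OpensMeasurableSpace E] (ψ : ℕ → C(E, ℝ≥0))
    (M : Set (ProbabilityMeasure E)) : Prop :=
  ∀ μ ∈ M, ∀ ε : ℝ≥0, 0 < ε → ∀ k : ℕ, ∃ a : ℝ≥0, 0 < a ∧
    ∃ U : Set (ProbabilityMeasure E), IsOpen U ∧ μ ∈ U ∧
      ∀ ν ∈ M ∩ U, (∫⁻ x in {x | a ≤ ψ k x}, (ψ k x : ℝ≥0∞) ∂(ν : Measure E)) ≤ (ε : ℝ≥0∞)

/-- Uniformly `(ψ_k)`-integrating sets of probability measures. -/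
def UniformlyIntegrating (ψ : ℕ → C(E, ℝ≥0)) (M : Set (ProbabilityMeasure E)) : Prop :=
  ∀ ε : ℝ≥0, 0 < ε → ∀ k : ℕ, ∃ a : ℝ≥0, 0 < a ∧
    (⨆ μ ∈ M, ∫⁻ x in {x | a ≤ ψ k x}, (ψ k x : ℝ≥0∞) ∂(μ : Measure E)) ≤ (ε : ℝ≥0∞)

end PsiWeak

end

/-! Split `φ = min φ a + (φ - a)⁺`. The first part is bounded and continuous, so weak convergence
controls it; the second has integral at most the tail at `a`, and twice that integral bounds the
tail at `2 * a` (`setLIntegral_gauge_le_two_mul`). Along a weakly convergent sequence, convergence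
of gauge integrals therefore forces small tails: (e) → (d). Conversely, locally uniformly small
tails make each `∫ f dμ` a locally uniform limit of integrals of clamped, bounded functions, hence
weakly continuous on `M` (`LocallyUniformlyIntegrating.continuous_integral`): (b) → (a). First
countability of the weak topology yields (d) → (b), a finite subcover yields (b) → (c), and
compactness of a convergent sequence with its limit yields (c) → (d). -/

namespace PsiWeak

/-! ### Tail integrals and uniform integrability -/

section Tail

variable {E : Type*} [TopologicalSpace E] [MeasurableSpace E]

/-- The tail integrals of a gauge function decrease in the cut-off level. -/
theorem setLIntegral_gauge_anti (φ : C(E, ℝ≥0)) (μ : Measure E) {a b : ℝ≥0} (hab : a ≤ b) :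
    (∫⁻ x in {x | b ≤ φ x}, (φ x : ℝ≥0∞) ∂μ) ≤ ∫⁻ x in {x | a ≤ φ x}, (φ x : ℝ≥0∞) ∂μ :=
  lintegral_mono_set fun _ hx => hab.trans hx

theorem UniformlyIntegrating.mono {ψ : ℕ → C(E, ℝ≥0)} {M N : Set (ProbabilityMeasure E)}
    (hN : UniformlyIntegrating ψ N) (h : M ⊆ N) : UniformlyIntegrating ψ M := fun ε hε k =>
  let ⟨a, ha, hle⟩ := hN ε hε k
  ⟨a, ha, (biSup_mono fun _ hμ => h hμ).trans hle⟩

variable [OpensMeasurableSpace E]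

theorem measurable_coe_gauge (φ : C(E, ℝ≥0)) : Measurable fun x => (φ x : ℝ≥0∞) :=
  φ.continuous.measurable.coe_nnreal_ennreal

theorem measurableSet_gauge_ge (φ : C(E, ℝ≥0)) (a : ℝ≥0) : MeasurableSet {x | a ≤ φ x} :=
  (isClosed_le continuous_const φ.continuous).measurableSet

/-- The tail integrals of an integrable gauge function tend to zero. -/
theorem tendsto_setLIntegral_gauge (φ : C(E, ℝ≥0)) (μ : Measure E)
    (hμ : (∫⁻ x, (φ x : ℝ≥0∞) ∂μ) < ∞) :
    Tendsto (fun n : ℕ => ∫⁻ x in {x | (n : ℝ≥0) ≤ φ x}, (φ x : ℝ≥0∞) ∂μ) atTop (𝓝 0) := by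
  have h := tendsto_lintegral_of_dominated_convergence (μ := μ)
    (F := fun n : ℕ => {x | (n : ℝ≥0) ≤ φ x}.indicator fun x => (φ x : ℝ≥0∞))
    (f := fun _ => 0) (fun x => (φ x : ℝ≥0∞))
    (fun n => (measurable_coe_gauge φ).indicator (measurableSet_gauge_ge φ n))
    (fun n => ae_of_all _ fun x => Set.indicator_le_self _ _ x) hμ.ne
    (ae_of_all _ fun x => by
      obtain ⟨m, hm⟩ := exists_nat_gt (φ x)
      refine tendsto_const_nhds.congr' ?_
      filter_upwards [eventually_ge_atTop m] with n hn
      rw [Set.indicator_of_notMem]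
      exact not_le.2 (hm.trans_le (by exact_mod_cast hn)))
  simpa only [lintegral_zero, lintegral_indicator (measurableSet_gauge_ge φ _)] using h

theorem exists_setLIntegral_gauge_le (φ : C(E, ℝ≥0)) (μ : Measure E)
    (hμ : (∫⁻ x, (φ x : ℝ≥0∞) ∂μ) < ∞) {ε : ℝ≥0} (hε : 0 < ε) :
    ∃ a : ℝ≥0, 0 < a ∧ (∫⁻ x in {x | a ≤ φ x}, (φ x : ℝ≥0∞) ∂μ) ≤ ε := by
  obtain ⟨n, hn, hn'⟩ := (((tendsto_setLIntegral_gauge φ μ hμ).eventually_le_const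
    (ENNReal.coe_pos.2 hε)).and (eventually_ge_atTop 1)).exists
  exact ⟨n, by exact_mod_cast hn', hn⟩

/-- The part of `φ` above level `a` is dominated by the tail integral at level `a`. -/
theorem lintegral_gauge_tsub_le (φ : C(E, ℝ≥0)) (μ : Measure E) (a : ℝ≥0) :
    (∫⁻ x, ((φ x - a : ℝ≥0) : ℝ≥0∞) ∂μ) ≤ ∫⁻ x in {x | a ≤ φ x}, (φ x : ℝ≥0∞) ∂μ := by
  rw [← lintegral_indicator (measurableSet_gauge_ge φ a)]
  refine lintegral_mono fun x => ?_
  by_cases hx : a ≤ φ x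
  · rw [Set.indicator_of_mem (show x ∈ {x | a ≤ φ x} from hx)]
    exact ENNReal.coe_le_coe.2 tsub_le_self
  · simp [tsub_eq_zero_of_le (le_of_not_ge hx)]

/-- The tail integral at level `2 * a` is at most twice the integral of the part above `a`. -/
theorem setLIntegral_gauge_le_two_mul (φ : C(E, ℝ≥0)) (μ : Measure E) (a : ℝ≥0) :
    (∫⁻ x in {x | 2 * a ≤ φ x}, (φ x : ℝ≥0∞) ∂μ) ≤
      2 * ∫⁻ x, ((φ x - a : ℝ≥0) : ℝ≥0∞) ∂μ := by
  rw [← lintegral_indicator (measurableSet_gauge_ge φ _),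
    ← lintegral_const_mul' _ _ ENNReal.ofNat_ne_top]
  refine lintegral_mono fun x => ?_
  by_cases hx : 2 * a ≤ φ x
  · rw [Set.indicator_of_mem (show x ∈ {x | 2 * a ≤ φ x} from hx)]
    -- Doubling the level matters: `2 * a ≤ φ x` gives `φ x + 2 * a ≤ 2 * φ x`.
    have h : φ x ≤ 2 * (φ x - a) := by
      rw [mul_tsub]
      refine le_tsub_of_add_le_left ?_
      rw [two_mul (φ x)]
      gcongr
    calc (φ x : ℝ≥0∞) ≤ ((2 * (φ x - a) : ℝ≥0) : ℝ≥0∞) := ENNReal.coe_le_coe.2 h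
      _ = 2 * ((φ x - a : ℝ≥0) : ℝ≥0∞) := by rw [ENNReal.coe_mul, ENNReal.coe_ofNat]
  · rw [Set.indicator_of_notMem (show x ∉ {x | 2 * a ≤ φ x} from hx)]
    exact zero_le

theorem lintegral_gauge_eq_min_add_tsub (φ : C(E, ℝ≥0)) (μ : Measure E) (a : ℝ≥0) :
    (∫⁻ x, (φ x : ℝ≥0∞) ∂μ) =
      (∫⁻ x, ((min (φ x) a : ℝ≥0) : ℝ≥0∞) ∂μ) + ∫⁻ x, ((φ x - a : ℝ≥0) : ℝ≥0∞) ∂μ := by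
  rw [← lintegral_add_left
    (φ.continuous.min continuous_const).measurable.coe_nnreal_ennreal]
  refine lintegral_congr fun x => ?_
  rw [← ENNReal.coe_add]
  congr 1
  rcases le_total (φ x) a with h | h
  · rw [min_eq_left h, tsub_eq_zero_of_le h, add_zero]
  · simp [h, add_tsub_cancel_of_le h]

/-- The truncation of a gauge function at level `a`. -/
def truncGauge (φ : C(E, ℝ≥0)) (a : ℝ≥0) : BoundedContinuousFunction E ℝ≥0 :=
  .mkOfBound ⟨fun x => min (φ x) a, φ.continuous.min continuous_const⟩ a fun x y => by
    rw [NNReal.dist_eq]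
    refine abs_sub_le_of_nonneg_of_le (NNReal.coe_nonneg _) ?_ (NNReal.coe_nonneg _) ?_
    · exact NNReal.coe_le_coe.2 (min_le_right _ _)
    · exact NNReal.coe_le_coe.2 (min_le_right _ _)

/-- The excess is a continuous substitute for the tail, whose indicator is not continuous; its
integral is a difference of two convergent ones. -/
theorem tendsto_lintegral_gauge_tsub {φ : C(E, ℝ≥0)} {ι : Type*} {l : Filter ι}
    {μ : ι → ProbabilityMeasure E} {μ₀ : ProbabilityMeasure E} (h : Tendsto μ l (𝓝 μ₀))
    (hint : Tendsto (fun n => ∫⁻ x, (φ x : ℝ≥0∞) ∂(μ n : Measure E)) l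
      (𝓝 (∫⁻ x, (φ x : ℝ≥0∞) ∂(μ₀ : Measure E))))
    (hμ₀ : (∫⁻ x, (φ x : ℝ≥0∞) ∂(μ₀ : Measure E)) < ∞) (a : ℝ≥0) :
    Tendsto (fun n => ∫⁻ x, ((φ x - a : ℝ≥0) : ℝ≥0∞) ∂(μ n : Measure E)) l
      (𝓝 (∫⁻ x, ((φ x - a : ℝ≥0) : ℝ≥0∞) ∂(μ₀ : Measure E))) := by
  have hmin := ProbabilityMeasure.tendsto_iff_forall_lintegral_tendsto.1 h (truncGauge φ a)
  have hfin : ∀ ν : ProbabilityMeasure E,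
      (∫⁻ x, (truncGauge φ a x : ℝ≥0∞) ∂(ν : Measure E)) ≠ ∞ := fun ν =>
    (BoundedContinuousFunction.lintegral_lt_top_of_nnreal (ν : Measure E) (truncGauge φ a)).ne
  have heq : ∀ ν : ProbabilityMeasure E,
      (∫⁻ x, (φ x : ℝ≥0∞) ∂(ν : Measure E)) -
        (∫⁻ x, (truncGauge φ a x : ℝ≥0∞) ∂(ν : Measure E)) =
      ∫⁻ x, ((φ x - a : ℝ≥0) : ℝ≥0∞) ∂(ν : Measure E) := fun ν => by
    rw [lintegral_gauge_eq_min_add_tsub φ _ a]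
    exact ENNReal.add_sub_cancel_left (hfin ν)
  simpa only [heq] using ENNReal.Tendsto.sub hint hmin (Or.inl hμ₀.ne)

theorem integral_gauge_eq_toReal (φ : C(E, ℝ≥0)) (μ : Measure E) :
    (∫ x, (φ x : ℝ) ∂μ) = (∫⁻ x, (φ x : ℝ≥0∞) ∂μ).toReal := by
  rw [integral_eq_lintegral_of_nonneg_ae (ae_of_all _ fun x => NNReal.coe_nonneg _)
    (NNReal.continuous_coe.comp φ.continuous).measurable.aestronglyMeasurable]
  simp only [ENNReal.ofReal_coe_nnreal]

/-- A weakly convergent sequence along which the gauge integrals converge is uniformly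
integrating. -/
theorem uniformlyIntegrating_range_of_tendsto {ψ : ℕ → C(E, ℝ≥0)}
    {μ : ℕ → ProbabilityMeasure E} {μ₀ : ProbabilityMeasure E}
    (hμ : ∀ n, μ n ∈ gaugeMeasures ψ) (hμ₀ : μ₀ ∈ gaugeMeasures ψ)
    (h : Tendsto μ atTop (𝓝 μ₀))
    (hint : ∀ k, Tendsto (fun n => ∫ x, (ψ k x : ℝ) ∂(μ n : Measure E)) atTop
      (𝓝 (∫ x, (ψ k x : ℝ) ∂(μ₀ : Measure E)))) :
    UniformlyIntegrating ψ (Set.range μ) := by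
  intro ε hε k
  have hlint : Tendsto (fun n => ∫⁻ x, (ψ k x : ℝ≥0∞) ∂(μ n : Measure E)) atTop
      (𝓝 (∫⁻ x, (ψ k x : ℝ≥0∞) ∂(μ₀ : Measure E))) := by
    rw [← ENNReal.tendsto_toReal_iff (fun n => (hμ n k).ne) (hμ₀ k).ne]
    simpa only [integral_gauge_eq_toReal] using hint k
  -- `ε / 4` leaves room for the strict bound `ε / 2` on the excess, which doubles to `ε`.
  obtain ⟨a, ha, hle⟩ := exists_setLIntegral_gauge_le (ψ k) μ₀ (hμ₀ k)
    (ε := ε / 4) (by positivity)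
  have hlt : (∫⁻ x, ((ψ k x - a : ℝ≥0) : ℝ≥0∞) ∂(μ₀ : Measure E)) < ((ε / 2 : ℝ≥0) : ℝ≥0∞) :=
    ((lintegral_gauge_tsub_le _ _ _).trans hle).trans_lt
      (ENNReal.coe_lt_coe.2 (by gcongr; norm_num))
  obtain ⟨N, hN⟩ := eventually_atTop.1
    ((tendsto_lintegral_gauge_tsub h hlint (hμ₀ k) a).eventually_lt_const hlt)
  choose b hb hble using fun n => exists_setLIntegral_gauge_le (ψ k) (μ n) (hμ n k) hε
  -- `2 * a` serves all `n ≥ N`; the supremum serves the finitely many earlier measures.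
  refine ⟨max (2 * a) ((Finset.range N).sup b),
    lt_max_of_lt_left (by positivity), ?_⟩
  refine iSup₂_le ?_
  rintro _ ⟨n, rfl⟩
  rcases le_or_gt N n with hn | hn
  · refine ((setLIntegral_gauge_anti _ _ (le_max_left _ _)).trans
      (setLIntegral_gauge_le_two_mul _ _ _)).trans ?_
    calc 2 * ∫⁻ x, ((ψ k x - a : ℝ≥0) : ℝ≥0∞) ∂(μ n : Measure E)
        ≤ 2 * ((ε / 2 : ℝ≥0) : ℝ≥0∞) := by gcongr; exact (hN n hn).le
      _ = ε := by
        rw [← ENNReal.coe_ofNat, ← ENNReal.coe_mul, mul_div_cancel₀ ε two_ne_zero]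
  · exact (setLIntegral_gauge_anti _ _ ((Finset.le_sup (Finset.mem_range.2 hn)).trans
      (le_max_right _ _))).trans (hble n)

theorem LocallyUniformlyIntegrating.uniformlyIntegrating_of_isCompact {ψ : ℕ → C(E, ℝ≥0)}
    {M K : Set (ProbabilityMeasure E)} (hM : LocallyUniformlyIntegrating ψ M) (hKM : K ⊆ M)
    (hK : IsCompact K) : UniformlyIntegrating ψ K := by
  intro ε hε k
  choose! a ha U hU hmem hle using fun μ hμ => hM μ hμ ε hε k
  obtain ⟨t, htK, htU⟩ := hK.elim_nhds_subcover U
    fun μ hμ => (hU μ (hKM hμ)).mem_nhds (hmem μ (hKM hμ))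
  refine ⟨max 1 (t.sup a), lt_max_of_lt_left one_pos, iSup₂_le fun ν hν => ?_⟩
  obtain ⟨μ, hμt, hνU⟩ := Set.mem_iUnion₂.1 (htU hν)
  exact (setLIntegral_gauge_anti _ _ ((Finset.le_sup hμt).trans (le_max_right _ _))).trans
    (hle μ (hKM (htK μ hμt)) ν ⟨hKM hν, hνU⟩)

/-- If local control fails at `μ`, a countable neighbourhood basis yields a sequence tending to `μ`
with tails above `ε` at ever higher levels. -/
theorem locallyUniformlyIntegrating_of_seq [FirstCountableTopology (ProbabilityMeasure E)]
    {ψ : ℕ → C(E, ℝ≥0)} {M : Set (ProbabilityMeasure E)}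
    (h : ∀ μ : ℕ → ProbabilityMeasure E, (∀ n, μ n ∈ M) →
      (∃ μ₀ ∈ M, Tendsto μ atTop (𝓝 μ₀)) → UniformlyIntegrating ψ (Set.range μ)) :
    LocallyUniformlyIntegrating ψ M := by
  intro μ hμ ε hε k
  by_contra! hcon
  obtain ⟨V, hV⟩ := (𝓝 μ).exists_antitone_basis
  -- The level is `n + 1` because `hcon` requires a positive one.
  have hex : ∀ n : ℕ, ∃ ν ∈ M ∩ interior (V n),
      (ε : ℝ≥0∞) < ∫⁻ x in {x | ((n + 1 : ℕ) : ℝ≥0) ≤ ψ k x}, (ψ k x : ℝ≥0∞)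
        ∂(ν : Measure E) := fun n =>
    hcon _ (by positivity) _ isOpen_interior (mem_interior_iff_mem_nhds.2 (hV.mem n))
  choose ν hν hlt using hex
  have htend : Tendsto ν atTop (𝓝 μ) :=
    hV.tendsto fun n => interior_subset (hν n).2
  obtain ⟨a, -, hle⟩ := h ν (fun n => (hν n).1) ⟨μ, hμ, htend⟩ ε hε k
  obtain ⟨n, hn⟩ := exists_nat_ge a
  refine (hlt n).not_ge ?_
  refine (setLIntegral_gauge_anti (ψ k) _ (hn.trans (by exact_mod_cast n.le_succ))).trans ?_
  exact (le_biSup (fun μ : ProbabilityMeasure E =>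
    ∫⁻ x in {x | a ≤ ψ k x}, (ψ k x : ℝ≥0∞) ∂(μ : Measure E)) (Set.mem_range_self n)).trans hle

end Tail

/-! ### Functions of gauge growth and their truncation -/

section Growth

variable {E : Type*} [TopologicalSpace E]

theorem gauge_mem_growthSpace (φ : C(E, ℝ≥0)) : (fun x => (φ x : ℝ)) ∈ growthSpace φ := by
  refine ⟨NNReal.continuous_coe.comp φ.continuous, 1, ?_⟩
  rintro _ ⟨x, rfl⟩
  have hx : (0 : ℝ) ≤ φ x := NNReal.coe_nonneg _
  change |(φ x : ℝ) / (1 + φ x)| ≤ 1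
  rw [abs_of_nonneg (by positivity)]
  exact div_le_one_of_le₀ (by linarith) (by positivity)

theorem boundedContinuous_mem_growthSpace (φ : C(E, ℝ≥0)) (f : BoundedContinuousFunction E ℝ) :
    (f : E → ℝ) ∈ growthSpace φ := by
  refine ⟨f.continuous, ‖f‖, ?_⟩
  rintro _ ⟨x, rfl⟩
  have hx : (0 : ℝ) ≤ φ x := NNReal.coe_nonneg _
  change |f x / (1 + φ x)| ≤ ‖f‖
  rw [abs_div, abs_of_nonneg (by positivity : (0 : ℝ) ≤ 1 + φ x)]
  exact (div_le_self (abs_nonneg _) (by linarith)).trans (f.norm_coe_le_norm x)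

theorem exists_abs_le_of_mem_growthSpace {φ : C(E, ℝ≥0)} {f : E → ℝ} (hf : f ∈ growthSpace φ) :
    ∃ C : ℝ≥0, 0 < C ∧ ∀ x, |f x| ≤ C * (1 + φ x) := by
  obtain ⟨B, hB⟩ := hf.2
  refine ⟨max 1 B.toNNReal, lt_max_of_lt_left one_pos, fun x => ?_⟩
  have hx : (0 : ℝ) < 1 + φ x := by positivity
  have h : |f x / (1 + φ x)| ≤ B := hB ⟨x, rfl⟩
  rw [abs_div, abs_of_pos hx, div_le_iff₀ hx] at h
  refine h.trans (mul_le_mul_of_nonneg_right ?_ hx.le)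
  exact (Real.le_coe_toNNReal B).trans (NNReal.coe_le_coe.2 (le_max_right _ _))

/-- The truncation of a continuous function to values in `[-c, c]`. -/
def clampFun (f : E → ℝ) (hf : Continuous f) (c : ℝ≥0) : BoundedContinuousFunction E ℝ :=
  .ofNormedAddCommGroup (fun x => max (-c) (min (f x) c))
    (continuous_const.max (hf.min continuous_const)) c fun x =>
      abs_le.2 ⟨le_max_left _ _, max_le (by linarith [c.coe_nonneg]) (min_le_right _ _)⟩

/-- Clamping at `C * (1 + a)` changes nothing where `φ ≤ a`; elsewhere it removes at most `C * (1 +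
φ) - C * (1 + a)`. -/
theorem abs_sub_clampFun_le {φ : C(E, ℝ≥0)} {f : E → ℝ} (hf : Continuous f) {C : ℝ≥0}
    (hC : ∀ x, |f x| ≤ C * (1 + φ x)) (a : ℝ≥0) (x : E) :
    |f x - clampFun f hf (C * (1 + a)) x| ≤ C * (φ x - a : ℝ≥0) := by
  have h := abs_le.1 (hC x)
  have hC0 := C.coe_nonneg
  have ha0 := a.coe_nonneg
  have hsub : (φ x : ℝ) - a ≤ (φ x - a : ℝ≥0) := by
    rw [NNReal.coe_sub_def]
    exact le_max_left _ _
  have hs0 : (0 : ℝ) ≤ (φ x - a : ℝ≥0) := NNReal.coe_nonneg _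
  have hmul := mul_le_mul_of_nonneg_left hsub hC0
  have hpos := mul_nonneg hC0 hs0
  have hca : (0 : ℝ) ≤ C * (1 + a) := by positivity
  change |f x - max (-((C * (1 + a) : ℝ≥0) : ℝ)) (min (f x) ((C * (1 + a) : ℝ≥0) : ℝ))| ≤ _
  push_cast
  rw [abs_le]
  rcases le_total (f x) (C * (1 + a)) with h1 | h1
  · rw [min_eq_left h1]
    rcases le_total (-(C * (1 + a) : ℝ)) (f x) with h2 | h2
    · rw [max_eq_right h2]
      constructor <;> linarith
    · rw [max_eq_left h2]
      constructor <;> linarith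
  · rw [min_eq_right h1, max_eq_right (by linarith)]
    constructor <;> linarith

end Growth

/-! ### Comparison of the two topologies -/

section Topology

variable {E : Type*} [TopologicalSpace E] [MeasurableSpace E]

theorem continuous_integral_gaugeWeakTopology (ψ : ℕ → C(E, ℝ≥0)) {k : ℕ} {f : E → ℝ}
    (hf : f ∈ growthSpace (ψ k)) :
    Continuous[gaugeWeakTopology ψ, inferInstance] fun μ : gaugeMeasures ψ =>
      ∫ x, f x ∂((μ : ProbabilityMeasure E) : Measure E) :=
  continuous_iff_le_induced.2 (iInf_le_of_le k (iInf₂_le f hf))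

variable [OpensMeasurableSpace E]

/-- The `(ψ_k)`-weak topology is finer than the relative weak topology. -/
theorem gaugeWeakTopology_le (ψ : ℕ → C(E, ℝ≥0)) :
    gaugeWeakTopology ψ ≤ TopologicalSpace.induced Subtype.val inferInstance := by
  rw [← continuous_iff_le_induced]
  let := gaugeWeakTopology ψ
  exact ProbabilityMeasure.continuous_iff_forall_continuous_integral.2 fun f =>
    -- Bounded functions lie in every growth space, so any index would do.
    continuous_integral_gaugeWeakTopology ψ (k := 0) (boundedContinuous_mem_growthSpace _ f)

theorem integrable_of_mem_growthSpace {φ : C(E, ℝ≥0)} {f : E → ℝ} (hf : f ∈ growthSpace φ)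
    (μ : ProbabilityMeasure E) (hμ : (∫⁻ x, (φ x : ℝ≥0∞) ∂(μ : Measure E)) < ∞) :
    Integrable f (μ : Measure E) := by
  obtain ⟨C, -, hC⟩ := exists_abs_le_of_mem_growthSpace hf
  have hφ : Integrable (fun x => (φ x : ℝ)) (μ : Measure E) := by
    refine ⟨(NNReal.continuous_coe.comp φ.continuous).measurable.aestronglyMeasurable, ?_⟩
    simpa [HasFiniteIntegral, enorm] using hμ
  exact (((integrable_const 1).add hφ).const_mul (C : ℝ)).mono'
    hf.1.measurable.aestronglyMeasurable (ae_of_all _ hC)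

/-- Truncating `f` changes its integral by at most a multiple of the tail integral of the gauge. -/
theorem abs_integral_sub_integral_clampFun_le {φ : C(E, ℝ≥0)} {f : E → ℝ}
    (hf : f ∈ growthSpace φ) {C : ℝ≥0} (hC : ∀ x, |f x| ≤ C * (1 + φ x))
    (μ : ProbabilityMeasure E) (hμ : (∫⁻ x, (φ x : ℝ≥0∞) ∂(μ : Measure E)) < ∞) {a ε : ℝ≥0}
    (hε : (∫⁻ x in {x | a ≤ φ x}, (φ x : ℝ≥0∞) ∂(μ : Measure E)) ≤ ε) :
    |(∫ x, f x ∂(μ : Measure E)) - ∫ x, clampFun f hf.1 (C * (1 + a)) x ∂(μ : Measure E)| ≤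
      C * ε := by
  rw [← integral_sub (integrable_of_mem_growthSpace hf μ hμ)
    (BoundedContinuousFunction.integrable _ _)]
  have h : (∫⁻ x, ENNReal.ofReal ‖f x - clampFun f hf.1 (C * (1 + a)) x‖ ∂(μ : Measure E)) ≤
      ((C * ε : ℝ≥0) : ℝ≥0∞) :=
    calc (∫⁻ x, ENNReal.ofReal ‖f x - clampFun f hf.1 (C * (1 + a)) x‖ ∂(μ : Measure E))
        ≤ ∫⁻ x, (C : ℝ≥0∞) * ((φ x - a : ℝ≥0) : ℝ≥0∞) ∂(μ : Measure E) := by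
          refine lintegral_mono fun x => ?_
          rw [← ENNReal.coe_mul]
          refine ENNReal.ofReal_le_of_le_toReal ?_
          exact abs_sub_clampFun_le hf.1 hC a x
      _ = C * ∫⁻ x, ((φ x - a : ℝ≥0) : ℝ≥0∞) ∂(μ : Measure E) :=
          lintegral_const_mul' _ _ ENNReal.coe_ne_top
      _ ≤ C * ε := by gcongr; exact (lintegral_gauge_tsub_le _ _ _).trans hε
      _ = ((C * ε : ℝ≥0) : ℝ≥0∞) := (ENNReal.coe_mul _ _).symm
  rw [← Real.norm_eq_abs]
  refine (norm_integral_le_lintegral_norm _).trans ?_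
  simpa using ENNReal.toReal_mono ENNReal.coe_ne_top h

/-- On a locally uniformly integrating set, integration against a function of gauge growth is
weakly continuous. -/
theorem LocallyUniformlyIntegrating.continuous_integral {ψ : ℕ → C(E, ℝ≥0)}
    {M : Set (ProbabilityMeasure E)} (hloc : LocallyUniformlyIntegrating ψ M)
    (hM : M ⊆ gaugeMeasures ψ) {k : ℕ} {f : E → ℝ} (hf : f ∈ growthSpace (ψ k)) :
    Continuous fun μ : M => ∫ x, f x ∂((μ : ProbabilityMeasure E) : Measure E) := by
  obtain ⟨C, hC0, hC⟩ := exists_abs_le_of_mem_growthSpace hf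
  refine continuous_of_locally_uniform_approx_of_continuousAt fun μ u hu => ?_
  obtain ⟨δ, hδ, hδu⟩ := Metric.mem_uniformity_dist.1 hu
  lift δ to ℝ≥0 using hδ.le
  have hδ' : 0 < δ := NNReal.coe_pos.1 hδ
  -- Truncation costs `C` times the tail bound, here `δ / 2 < δ`.
  obtain ⟨a, -, U, hU, hμU, hle⟩ := hloc μ μ.2 (δ / 2 / C) (by positivity) k
  refine ⟨Subtype.val ⁻¹' U, (hU.preimage continuous_subtype_val).mem_nhds hμU,
    fun ν => ∫ x, clampFun f hf.1 (C * (1 + a)) x ∂((ν : ProbabilityMeasure E) : Measure E),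
    ((ProbabilityMeasure.continuous_integral_boundedContinuousFunction _).comp
      continuous_subtype_val).continuousAt, fun ν hν => hδu ?_⟩
  refine (abs_integral_sub_integral_clampFun_le hf hC ν (hM ν.2 k)
    (hle ν ⟨ν.2, hν⟩)).trans_lt ?_
  rw [← NNReal.coe_mul, mul_div_cancel₀ _ hC0.ne']
  exact_mod_cast half_lt_self hδ'

theorem LocallyUniformlyIntegrating.isWSet {ψ : ℕ → C(E, ℝ≥0)}
    {M : Set (ProbabilityMeasure E)} (hloc : LocallyUniformlyIntegrating ψ M)
    (hM : M ⊆ gaugeMeasures ψ) : IsWSet ψ M hM := by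
  refine le_antisymm ?_ ?_
  · refine (induced_mono (gaugeWeakTopology_le ψ)).trans ?_
    rw [induced_compose]
    rfl
  · simp only [gaugeWeakTopology, induced_iInf, induced_compose]
    exact le_iInf fun k => le_iInf₂ fun f hf =>
      continuous_iff_le_induced.1 (hloc.continuous_integral hM hf)

theorem IsWSet.tendsto_integral {ψ : ℕ → C(E, ℝ≥0)} {M : Set (ProbabilityMeasure E)}
    {hM : M ⊆ gaugeMeasures ψ} (h : IsWSet ψ M hM) {k : ℕ} {f : E → ℝ}
    (hf : f ∈ growthSpace (ψ k)) {ι : Type*} {l : Filter ι} {μ : ι → ProbabilityMeasure E}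
    (hμ : ∀ n, μ n ∈ M) {μ₀ : ProbabilityMeasure E} (hμ₀ : μ₀ ∈ M) (ht : Tendsto μ l (𝓝 μ₀)) :
    Tendsto (fun n => ∫ x, f x ∂(μ n : Measure E)) l (𝓝 (∫ x, f x ∂(μ₀ : Measure E))) := by
  have hcont : Continuous fun ν : M => ∫ x, f x ∂((ν : ProbabilityMeasure E) : Measure E) := by
    rw [continuous_iff_le_induced]
    refine (le_of_eq h.symm).trans ?_
    refine (induced_mono (continuous_iff_le_induced.1
      (continuous_integral_gaugeWeakTopology ψ hf))).trans ?_
    rw [induced_compose]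
    rfl
  have ht' : Tendsto (fun n => (⟨μ n, hμ n⟩ : M)) l (𝓝 ⟨μ₀, hμ₀⟩) := tendsto_subtype_rng.2 ht
  exact (hcont.tendsto ⟨μ₀, hμ₀⟩).comp ht'

end Topology

end PsiWeak

theorem mainTheorem1 {E : Type*} [TopologicalSpace E] [PolishSpace E] [MeasurableSpace E]
    [BorelSpace E] (ψ : ℕ → C(E, ℝ≥0)) (M : Set (ProbabilityMeasure E))
    (hM : M ⊆ PsiWeak.gaugeMeasures ψ) :
    List.TFAE [
      PsiWeak.IsWSet ψ M hM,
      PsiWeak.LocallyUniformlyIntegrating ψ M,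
      ∀ K : Set (ProbabilityMeasure E), K ⊆ M → IsCompact K → PsiWeak.UniformlyIntegrating ψ K,
      ∀ μ : ℕ → ProbabilityMeasure E, (∀ n, μ n ∈ M) →
        (∃ μ₀ ∈ M, Tendsto μ atTop (𝓝 μ₀)) → PsiWeak.UniformlyIntegrating ψ (Set.range μ),
      ∀ μ : ℕ → ProbabilityMeasure E, (∀ n, μ n ∈ M) → ∀ μ₀ ∈ M,
        Tendsto μ atTop (𝓝 μ₀) →
          ∀ k : ℕ, Tendsto (fun n => ∫ x, (ψ k x : ℝ) ∂(μ n : Measure E)) atTop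
            (𝓝 (∫ x, (ψ k x : ℝ) ∂(μ₀ : Measure E)))] := by
  -- This is where `E` being Polish enters; it lets sequences detect neighbourhoods in (d) → (b).
  have : FirstCountableTopology (ProbabilityMeasure E) := inferInstance
  tfae_have 1 → 5 := fun h μ hμ μ₀ hμ₀ ht k =>
    h.tendsto_integral (PsiWeak.gauge_mem_growthSpace (ψ k)) hμ hμ₀ ht
  tfae_have 5 → 4 := fun h μ hμ ⟨μ₀, hμ₀, ht⟩ =>
    PsiWeak.uniformlyIntegrating_range_of_tendsto (fun n => hM (hμ n)) (hM hμ₀) ht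
      (h μ hμ μ₀ hμ₀ ht)
  tfae_have 4 → 2 := PsiWeak.locallyUniformlyIntegrating_of_seq
  tfae_have 2 → 3 := fun h K hKM hK => h.uniformlyIntegrating_of_isCompact hKM hK
  tfae_have 3 → 4 := fun h μ hμ ⟨μ₀, hμ₀, ht⟩ =>
    (h _ (Set.insert_subset hμ₀ (Set.range_subset_iff.2 hμ)) ht.isCompact_insert_range).mono
      (Set.subset_insert _ _)
  tfae_have 2 → 1 := fun h => h.isWSet hM
  tfae_finish
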